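/- Let $d\ge 1$ and let $f_0:\mathbb R^d\to[0,\infty)$ be a probability density (with respect to Lebesgue measure) that vanishes outside $[0,1]^d$; let $\mathcal P_0$ be the distribution with density $f_0$, let $f_1=\mathbf 1_{[0,1]^d}$ be the uniform density, and let $A=\{x: f_0(x)>0\}$ be the support of $f_0$. Define the p-value $$p(\eta)=\mathcal P_0\Big(x:\ \frac{f_1(x)}{f_0(x)}\ \ge\ \frac{f_1(\eta)}{f_0(\eta)}\Big),\qquad \eta\in[0,1]^d,$$ where the ratio is $+\infty$ if $f_0=0<f_1$. Assume: 1. the likelihood ratio has no flat spots: $\mathcal P_0\big(x: f_1(x)/f_0(x)=c\big)=0$ for every $c\in[0,\infty]$; 2. $f_0$ is twice differentiable on the interior of $A$, and there are a real number $\lambda_M$ and a symmetric matrix $M$ with $\lambda_{\max}(M)\le\lambda_M$ such that the Hessian satisfies $H(x)\preceq M$ for all $x$ in the interior of $A$; 3. there is $\beta>0$ with $f_0(x)\ge\beta$ for all $x\in A$. Let $x_0,x_1,x_2,\dots$ be i.i.d. with density $f_0$. For $n=2m+1$ split the training set $\{x_0,\dots,x_{2m}\}$ into $S_1=\{x_0,\dots,x_m\}$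 and $S_2=\{x_{m+1},\dots,x_{2m}\}$. For $K\ge1$ let $R_{S_2}(\eta)$ be the Euclidean distance from $\eta$ to its $K$-th nearest neighbor in $S_2$, let $R_{S_1}(x_i)$ be the Euclidean distance from $x_i\in S_1$ to its $K$-th nearest neighbor in $S_1\setminus\{x_i\}$, and set $$\hat p_K(\eta)=\frac1m\sum_{x_i\in S_1}\mathbb I_{\{R_{S_2}(\eta)\le R_{S_1}(x_i)\}} .$$ Let $K=K_m$ be any sequence of integers of exact order $m^{2/5}$, that is, $c\,m^{2/5}\le K_m\le C\,m^{2/5}$ for all large $m$, with constants $0<c\le C$. Then for every $\eta\in[0,1]^d$ that does not lie on the topological boundary (in $\mathbb R^d$) of $A$, $$|\hat p_K(\eta)-p(\eta)|\longrightarrow 0\quad\text{almost surely as } n=2m+1\to\infty .$$ -/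

import Mathlib

open MeasureTheory ProbabilityTheory Filter Topology Asymptotics
open scoped ENNReal

namespace LPE

/-- The unit cube `[0,1]^d` in Euclidean space. -/
def cube (d : ℕ) : Set (EuclideanSpace ℝ (Fin d)) :=
  {x | ∀ i, x i ∈ Set.Icc (0 : ℝ) 1}

/-- `f` is a probability density (with respect to Lebesgue measure) supported in `[0,1]^d`. -/
structure IsCubeDensity {d : ℕ} (f : EuclideanSpace ℝ (Fin d) → ℝ) : Prop where
  measurable : Measurable f
  nonneg : ∀ x, 0 ≤ f x
  eq_zero_of_notMem : ∀ x, x ∉ cube d → f x = 0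
  lintegral_eq_one : ∫⁻ x, ENNReal.ofReal (f x) = 1

/-- The measure with Lebesgue density `f`. -/
noncomputable def law {d : ℕ} (f : EuclideanSpace ℝ (Fin d) → ℝ) :
    Measure (EuclideanSpace ℝ (Fin d)) :=
  volume.withDensity fun x => ENNReal.ofReal (f x)

/-- The density of the uniform distribution on `[0,1]^d`. -/
noncomputable def uniformDensity (d : ℕ) : EuclideanSpace ℝ (Fin d) → ℝ :=
  (cube d).indicator fun _ => 1

/-- The likelihood ratio `f₁ / f₀`, with value `∞` where `f₀ = 0 < f₁`. -/
noncomputable def likelihoodRatio {d : ℕ} (f₁ f₀ : EuclideanSpace ℝ (Fin d) → ℝ)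
    (x : EuclideanSpace ℝ (Fin d)) : ℝ≥0∞ :=
  ENNReal.ofReal (f₁ x) / ENNReal.ofReal (f₀ x)

/-- The likelihood ratio has no flat spots of non-zero nominal probability. -/
def NoFlatSpots {d : ℕ} (f₁ f₀ : EuclideanSpace ℝ (Fin d) → ℝ) : Prop :=
  ∀ c : ℝ≥0∞, law f₀ {x | likelihoodRatio f₁ f₀ x = c} = 0

/-- The p-value `p(η) = P₀ (x : f₁(x)/f₀(x) ≥ f₁(η)/f₀(η))`. -/
noncomputable def pValue {d : ℕ} (f₁ f₀ : EuclideanSpace ℝ (Fin d) → ℝ)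
    (η : EuclideanSpace ℝ (Fin d)) : ℝ :=
  (law f₀).real {x | likelihoodRatio f₁ f₀ η ≤ likelihoodRatio f₁ f₀ x}

/-- The Hessian matrix of `f` at `x`. -/
noncomputable def hessian {d : ℕ} (f : EuclideanSpace ℝ (Fin d) → ℝ)
    (x : EuclideanSpace ℝ (Fin d)) : Matrix (Fin d) (Fin d) ℝ :=
  Matrix.of fun i j =>
    fderiv ℝ (fderiv ℝ f) x (EuclideanSpace.single i 1) (EuclideanSpace.single j 1)

/-- `f` is twice differentiable on the open set `U`, and its Hessian is dominated on `U`, in the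
Loewner order, by a single symmetric matrix whose largest eigenvalue is at most `lam`. -/
def HessianDominatedOn {d : ℕ} (f : EuclideanSpace ℝ (Fin d) → ℝ)
    (U : Set (EuclideanSpace ℝ (Fin d))) (lam : ℝ) : Prop :=
  DifferentiableOn ℝ f U ∧ DifferentiableOn ℝ (fderiv ℝ f) U ∧
    ∃ (M : Matrix (Fin d) (Fin d) ℝ) (hM : M.IsHermitian),
      (∀ i, hM.eigenvalues i ≤ lam) ∧ ∀ x ∈ U, (M - hessian f x).PosSemidef

/-- The distance from `y` to its `K`-th nearest neighbour among the points `x j`, `j ∈ J`: the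
least radius `r` such that at least `K` of these points lie within distance `r` of `y`
(meaningful for `1 ≤ K ≤ J.card`). -/
noncomputable def knnDist {d : ℕ} (K : ℕ) (x : ℕ → EuclideanSpace ℝ (Fin d)) (J : Finset ℕ)
    (y : EuclideanSpace ℝ (Fin d)) : ℝ :=
  sInf {r : ℝ | 0 ≤ r ∧ K ≤ (J.filter fun j => dist y (x j) ≤ r).card}

/-- The split-sample K-LPE score of `η` from the `n = 2m+1` points `x 0, …, x (2m)`, with
`S₁ = {x 0, …, x m}` and `S₂ = {x (m+1), …, x (2m)}`:
`(1/m) ∑_{x i ∈ S₁} 1{R_{S₂}(η) ≤ R_{S₁}(x i)}`, where the neighbours of `x i` are sought in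
`S₁` without `x i` itself. -/
noncomputable def score {d : ℕ} (K m : ℕ) (x : ℕ → EuclideanSpace ℝ (Fin d))
    (η : EuclideanSpace ℝ (Fin d)) : ℝ :=
  (1 / (m : ℝ)) * ∑ i ∈ Finset.range (m + 1),
    {r : ℝ | knnDist K x (Finset.Ioc m (2 * m)) η ≤ r}.indicator (fun _ => (1 : ℝ))
      (knnDist K x ((Finset.range (m + 1)).erase i) (x i))

end LPE

/-! Write `f` for the nominal density. On the cube the likelihood ratio is `1 / f`, so the p-value
is the mass of `{f ≤ f η}`. The score compares two random neighbour distances; the proof separates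
them by one deterministic radius `r m`, whose ball has volume `K m / (m u)`, so that a point of
local density `u` expects exactly `K m` neighbours among `m` sample points. If `f η < u`, the ball
at `η` holds fewer than `K m` points of `S₂`, hence the distance from `η` exceeds `r m`; sample
points whose ball mass reflects a density above `u` have their distance at most `r m` and contribute
nothing. With `u < f η` the inequalities reverse. Chernoff's bound makes each failure exponentially
small in `K m`. The order `m ^ (2/5)` lets Borel–Cantelli absorb a union over the `m + 1` points of
`S₁` (`ae_eventually_forall_ballCount_notMem`), while `K m / m → 0` shrinks the balls. Ball mass
over volume tends to the density: almost everywhere by Lebesgue differentiation, and at `η` by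
continuity. The score is thus bounded by frequencies of `m`-dependent sets, controlled by the strong
law. Letting the threshold tend to `f η` on either side gives the limit, as `{f < f η}` and `{f ≤ f
η}` have equal mass when there are no flat spots. -/

namespace LPE

/-! ### Counting points in a ball -/

/-- The number of points `x j`, `j ∈ J`, within distance `r` of `y`. -/
noncomputable def ballCount {E : Type*} [PseudoMetricSpace E] (x : ℕ → E) (J : Finset ℕ) (y : E)
    (r : ℝ) : ℕ :=
  (J.filter fun j => dist y (x j) ≤ r).card

lemma ballCount_eq_sum_indicator {E : Type*} [PseudoMetricSpace E] (x : ℕ → E) (J : Finset ℕ)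
    (y : E) (r : ℝ) :
    (ballCount x J y r : ℝ) =
      ∑ j ∈ J, (Metric.closedBall y r).indicator (fun _ => (1 : ℝ)) (x j) := by
  rw [ballCount, Finset.card_filter]
  push_cast
  refine Finset.sum_congr rfl fun j _ => ?_
  by_cases h : dist y (x j) ≤ r
  · rw [Set.indicator_of_mem (Metric.mem_closedBall'.2 h), if_pos h]
  · rw [Set.indicator_of_notMem (fun h' => h (Metric.mem_closedBall'.1 h')), if_neg h]

/-- Within a finite family, the infimum defining the `K`-th nearest neighbour distance is attained. -/
lemma knnDist_le_iff {d : ℕ} {K : ℕ} {x : ℕ → EuclideanSpace ℝ (Fin d)} {J : Finset ℕ}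
    {y : EuclideanSpace ℝ (Fin d)} {r : ℝ} (hr : 0 ≤ r) (hK : K ≤ J.card) :
    knnDist K x J y ≤ r ↔ K ≤ ballCount x J y r := by
  constructor
  · intro h
    by_contra! hlt
    -- The count is right-continuous in the radius: finitely many distances leave a gap after `r`.
    obtain ⟨s, hrs, hs⟩ : ∃ s, r < s ∧ ∀ t < s, ballCount x J y t ≤ ballCount x J y r := by
      have hfin : ∀ᶠ t in 𝓝[>] r, ∀ j ∈ J, r < dist y (x j) → t < dist y (x j) := by
        rw [Filter.eventually_all_finset]
        intro j _
        by_cases hj : r < dist y (x j)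
        · filter_upwards [nhdsWithin_le_nhds (Iio_mem_nhds hj)] with t ht _ using ht
        · exact Eventually.of_forall fun t h' => absurd h' hj
      obtain ⟨s, hs, hsr⟩ := (hfin.and self_mem_nhdsWithin).exists
      refine ⟨s, hsr, fun t ht => Finset.card_le_card fun j hj => ?_⟩
      simp only [Finset.mem_filter] at hj ⊢
      refine ⟨hj.1, ?_⟩
      by_contra! h'
      exact absurd (hs j hj.1 h') (by linarith [hj.2])
    refine absurd h (not_le.2 (hrs.trans_le (le_csInf ?_ ?_)))
    -- A radius covering all of `J`; nonemptiness matters because `sInf ∅ = 0`.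
    · refine ⟨∑ j ∈ J, dist y (x j), Finset.sum_nonneg fun _ _ => dist_nonneg, ?_⟩
      rwa [Finset.filter_true_of_mem]
      intro j hj
      exact Finset.single_le_sum (f := fun j => dist y (x j)) (fun _ _ => dist_nonneg) hj
    · rintro t ⟨_, ht⟩
      by_contra! hts
      exact absurd (ht.trans (hs t hts)) (not_le.2 hlt)
  · intro h
    exact csInf_le ⟨0, fun s hs => hs.1⟩ ⟨hr, h⟩

/-! ### Chernoff bounds -/

section Chernoff

variable {Ω E : Type*} [MeasurableSpace Ω] [MeasurableSpace E] {μ : Measure Ω}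
  [IsProbabilityMeasure μ] {P : Measure E} {X : ℕ → Ω → E}

/-- The Bernoulli transform `1 + p (e^s - 1)` is bounded by its Poisson analogue through `1 + x ≤
e^x`. The sign of `s` is free, to serve both tails. -/
lemma mgf_indicator_comp_le {Y : Ω → E} (hY : Measurable Y) (hP : μ.map Y = P) {A : Set E}
    (hA : MeasurableSet A) (s : ℝ) :
    mgf (A.indicator (fun _ => (1 : ℝ)) ∘ Y) μ s ≤ Real.exp (P.real A * (Real.exp s - 1)) := by
  have hint : ∀ ω, Real.exp (s * (A.indicator (fun _ => (1 : ℝ)) ∘ Y) ω)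
      = 1 + (Y ⁻¹' A).indicator (fun _ => Real.exp s - 1) ω := by
    intro ω
    by_cases h : Y ω ∈ A <;> simp [h]
  have hPA : P.real A = μ.real (Y ⁻¹' A) := by
    rw [← hP, map_measureReal_apply hY hA]
  simp only [mgf, hint]
  rw [integral_add (integrable_const _) ((integrable_const _).indicator (hY hA)),
    integral_indicator_const _ (hY hA), hPA]
  simp only [integral_const, probReal_univ, smul_eq_mul, mul_one]
  linarith [Real.add_one_le_exp (μ.real (Y ⁻¹' A) * (Real.exp s - 1))]

lemma mgf_sum_indicator_le (hX : ∀ i, Measurable (X i)) (hind : iIndepFun X μ)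
    (hP : ∀ i, μ.map (X i) = P) {A : Set E} (hA : MeasurableSet A) (J : Finset ℕ) (s : ℝ) :
    mgf (∑ j ∈ J, A.indicator (fun _ => (1 : ℝ)) ∘ X j) μ s
      ≤ Real.exp (J.card * P.real A * (Real.exp s - 1)) := by
  have hm : Measurable (A.indicator (fun _ => (1 : ℝ))) := measurable_const.indicator hA
  rw [(hind.comp (fun _ => A.indicator (fun _ => (1 : ℝ))) fun _ => hm).mgf_sum
    (fun i => hm.comp (hX i)) J]
  calc ∏ i ∈ J, mgf (A.indicator (fun _ => (1 : ℝ)) ∘ X i) μ s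
      ≤ ∏ i ∈ J, Real.exp (P.real A * (Real.exp s - 1)) :=
        Finset.prod_le_prod (fun _ _ => mgf_nonneg)
          fun i _ => mgf_indicator_comp_le (hX i) (hP i) hA s
    _ = _ := by
        rw [Finset.prod_const, ← Real.exp_nat_mul]
        ring_nf

lemma integrable_exp_sum_indicator (hX : ∀ i, Measurable (X i)) {A : Set E}
    (hA : MeasurableSet A) (J : Finset ℕ) (s : ℝ) :
    Integrable (fun ω => Real.exp (s * (∑ j ∈ J, A.indicator (fun _ => (1 : ℝ)) ∘ X j) ω)) μ := by
  have hm : Measurable (A.indicator (fun _ => (1 : ℝ))) := measurable_const.indicator hA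
  have hms : Measurable (∑ j ∈ J, A.indicator (fun _ => (1 : ℝ)) ∘ X j) :=
    Finset.sum_induction _ Measurable (fun _ _ => Measurable.add) measurable_zero
      fun i _ => hm.comp (hX i)
  refine Integrable.of_bound (C := Real.exp (|s| * J.card)) (by fun_prop)
    (Eventually.of_forall fun ω => ?_)
  rw [Real.norm_eq_abs, Real.abs_exp, Real.exp_le_exp]
  refine (le_abs_self _).trans ?_
  rw [abs_mul]
  refine mul_le_mul_of_nonneg_left ?_ (abs_nonneg s)
  rw [Finset.sum_apply]
  refine (Finset.abs_sum_le_sum_abs _ _).trans ?_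
  refine (Finset.sum_le_card_nsmul _ _ 1 fun j _ => ?_).trans (by simp)
  by_cases h : X j ω ∈ A <;> simp [h]

/-- Chernoff's bound for the upper tail of a binomial count. -/
lemma measureReal_le_sum_indicator_le (hX : ∀ i, Measurable (X i)) (hind : iIndepFun X μ)
    (hP : ∀ i, μ.map (X i) = P) {θ : ℝ} (hθ0 : 0 ≤ θ) (hθ : θ < 1) :
    ∃ c > 0, ∀ (A : Set E) (J : Finset ℕ) (k : ℝ), MeasurableSet A → 0 ≤ k →
      J.card * P.real A ≤ θ * k →
      μ.real {ω | k ≤ ∑ j ∈ J, A.indicator (fun _ => (1 : ℝ)) (X j ω)} ≤ Real.exp (-c * k) := by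
  -- With `θ = 1 - 2s` and `e^s - 1 ≤ s + s²`, the exponent per unit of `k` is at most `-s²`. It
  -- depends on `θ` alone, hence is uniform in `A`, `J` and `k`.
  set s : ℝ := (1 - θ) / 2 with hs
  have hs0 : 0 < s := by linarith
  refine ⟨s ^ 2, by positivity, fun A J k hA hk hle => ?_⟩
  have h := measure_ge_le_exp_mul_mgf (μ := μ) k hs0.le (integrable_exp_sum_indicator hX hA J s)
  simp only [Finset.sum_apply, Function.comp_apply] at h
  refine h.trans ?_
  have he : Real.exp s - 1 ≤ s + s ^ 2 := by
    have := (abs_le.1 (Real.abs_exp_sub_one_sub_id_le (x := s)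
      (by rw [abs_of_pos hs0]; linarith))).2
    linarith
  have he0 : 0 ≤ Real.exp s - 1 := by linarith [Real.add_one_le_exp s]
  refine (mul_le_mul_of_nonneg_left (mgf_sum_indicator_le hX hind hP hA J s)
    (Real.exp_pos _).le).trans ?_
  rw [← Real.exp_add, Real.exp_le_exp]
  have h1 : J.card * P.real A * (Real.exp s - 1) ≤ θ * k * (s + s ^ 2) :=
    mul_le_mul hle he he0 (by positivity)
  have h2 : θ * (s + s ^ 2) - s ≤ - s ^ 2 := by
    have : θ = 1 - 2 * s := by linarith
    rw [this]
    nlinarith [pow_pos hs0 3]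
  nlinarith [mul_le_mul_of_nonneg_right h2 hk]

/-- Chernoff's bound for the lower tail of a binomial count. -/
lemma measureReal_sum_indicator_le_le (hX : ∀ i, Measurable (X i)) (hind : iIndepFun X μ)
    (hP : ∀ i, μ.map (X i) = P) {θ : ℝ} (hθ : 1 < θ) :
    ∃ c > 0, ∀ (A : Set E) (J : Finset ℕ) (k : ℝ), MeasurableSet A → 0 ≤ k →
      θ * k ≤ J.card * P.real A →
      μ.real {ω | ∑ j ∈ J, A.indicator (fun _ => (1 : ℝ)) (X j ω) ≤ k} ≤ Real.exp (-c * k) := by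
  -- This `s` maximises `θ (s - s²) - s`, the rate left after `1 - e^(-s) ≥ s - s²`.
  set s : ℝ := (θ - 1) / (2 * θ) with hs
  have hθs : θ * s = (θ - 1) / 2 := by rw [hs]; field_simp
  have hs0 : 0 < s := div_pos (by linarith) (by linarith)
  have hs1 : s ≤ 1 := by
    rw [hs, div_le_one (by linarith)]; linarith
  refine ⟨s * ((θ - 1) / 2), by positivity, fun A J k hA hk hle => ?_⟩
  have h := measure_le_le_exp_mul_mgf (μ := μ) k (t := -s) (by linarith)
    (integrable_exp_sum_indicator hX hA J (-s))
  simp only [Finset.sum_apply, Function.comp_apply] at h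
  refine h.trans ?_
  have he : s - s ^ 2 ≤ 1 - Real.exp (-s) := by
    have := (abs_le.1 (Real.abs_exp_sub_one_sub_id_le (x := -s)
      (by rw [abs_neg, abs_of_pos hs0]; linarith))).2
    nlinarith
  refine (mul_le_mul_of_nonneg_left (mgf_sum_indicator_le hX hind hP hA J (-s))
    (Real.exp_pos _).le).trans ?_
  rw [← Real.exp_add, Real.exp_le_exp]
  have h1 : θ * k * (s - s ^ 2) ≤ J.card * P.real A * (1 - Real.exp (-s)) :=
    mul_le_mul hle he (by nlinarith) (by positivity)
  have h2 : θ * (s - s ^ 2) - s = s * ((θ - 1) / 2) := by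
    linear_combination (-s) * hθs
  nlinarith [congrArg (· * k) h2]

end Chernoff

/-! ### Conditioning on one point -/

lemma measure_mem_and_prodMk_mem_le {Ω E F : Type*} [MeasurableSpace Ω]
    [MeasurableSpace E] [MeasurableSpace F] {μ : Measure Ω} [IsProbabilityMeasure μ]
    {Y : Ω → E} {Z : Ω → F} (hY : Measurable Y) (hZ : Measurable Z) (h : Y ⟂ᵢ[μ] Z)
    {D : Set E} (hD : MeasurableSet D) {B : Set (E × F)} (hB : MeasurableSet B) {c : ℝ≥0∞}
    (hc : ∀ y ∈ D, μ {ω | (y, Z ω) ∈ B} ≤ c) :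
    μ {ω | Y ω ∈ D ∧ (Y ω, Z ω) ∈ B} ≤ c := by
  have hmap := (indepFun_iff_map_prod_eq_prod_map_map hY.aemeasurable hZ.aemeasurable).1 h
  have hS : MeasurableSet ((D ×ˢ Set.univ) ∩ B) := (hD.prod MeasurableSet.univ).inter hB
  have : IsProbabilityMeasure (μ.map Y) := Measure.isProbabilityMeasure_map hY.aemeasurable
  calc μ {ω | Y ω ∈ D ∧ (Y ω, Z ω) ∈ B}
      = μ.map (fun ω => (Y ω, Z ω)) ((D ×ˢ Set.univ) ∩ B) := by
        rw [Measure.map_apply (hY.prodMk hZ) hS]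
        congr 1
        ext ω
        simp
    _ = ∫⁻ y, μ.map Z (Prod.mk y ⁻¹' ((D ×ˢ Set.univ) ∩ B)) ∂(μ.map Y) := by
        rw [hmap, Measure.prod_apply hS]
    _ ≤ ∫⁻ _, c ∂(μ.map Y) := by
        refine lintegral_mono fun y => ?_
        rw [Measure.map_apply hZ (measurable_prodMk_left hS)]
        by_cases hy : y ∈ D
        · exact (measure_mono fun ω hω => hω.2).trans (hc y hy)
        · refine (measure_mono_null (t := ∅) (fun ω hω => hy ?_) measure_empty).le.trans zero_le
          exact hω.1.1
    _ = c := by simp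

/-- Since `i ∉ J`, the random centre is independent of the counted points, so Tonelli transfers a
bound for fixed centres to it. -/
lemma measure_mem_and_ballCount_le {Ω : Type*} [MeasurableSpace Ω] {μ : Measure Ω}
    [IsProbabilityMeasure μ] {E : Type*} [PseudoMetricSpace E] [MeasurableSpace E]
    [OpensMeasurableSpace E] [SecondCountableTopology E] {X : ℕ → Ω → E}
    (hX : ∀ i, Measurable (X i)) (hind : iIndepFun X μ) {D : Set E} (hD : MeasurableSet D)
    (T : Set ℕ) (r : ℝ) {J : Finset ℕ} {i : ℕ} (hi : i ∉ J) {c : ℝ≥0∞}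
    (hc : ∀ y ∈ D, μ {ω | ballCount (fun j => X j ω) J y r ∈ T} ≤ c) :
    μ {ω | X i ω ∈ D ∧ ballCount (fun j => X j ω) J (X i ω) r ∈ T} ≤ c := by
  have hIJ : X i ⟂ᵢ[μ] (fun ω (j : J) => X j ω) := by
    have h := hind.indepFun_finset {i} J (by simpa using hi) hX
    exact h.comp (φ := fun z : ({i} : Finset ℕ) → E => z ⟨i, by simp⟩) (ψ := id)
      (measurable_pi_apply _) measurable_id
  let N : E × (J → E) → ℝ := fun p => ∑ j : J, {q : E × E | dist q.1 q.2 ≤ r}.indicator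
    (fun _ => (1 : ℝ)) (p.1, p.2 j)
  have hN : Measurable N := by
    refine Finset.measurable_sum _ fun j _ => ?_
    have hq : Measurable fun p : E × (J → E) => (p.1, p.2 j) := by fun_prop
    exact (measurable_const.indicator (measurableSet_le measurable_dist measurable_const)).comp hq
  have hNc : ∀ y ω, N (y, fun j : J => X j ω) = ballCount (fun j => X j ω) J y r := by
    intro y ω
    rw [ballCount, Finset.card_filter]
    push_cast
    rw [← Finset.sum_coe_sort J]
    refine Finset.sum_congr rfl fun j _ => ?_
    simp [Set.indicator_apply]
  have hB : MeasurableSet (N ⁻¹' ((fun n : ℕ => (n : ℝ)) '' T)) :=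
    hN ((Set.to_countable T).image _).measurableSet
  have key := measure_mem_and_prodMk_mem_le (hX i)
    (measurable_pi_lambda (fun ω (j : J) => X j ω) fun j => hX j) hIJ hD hB (c := c) ?_
  · simpa [hNc] using key
  · intro y hy
    simpa [hNc] using hc y hy

/-! ### Almost sure statements -/

lemma summable_succ_mul_exp_neg {K : ℕ → ℕ}
    (hK : (fun m : ℕ => (m : ℝ) ^ (2 / 5 : ℝ)) =O[atTop] fun m => (K m : ℝ)) {c : ℝ}
    (hc : 0 < c) : Summable fun m : ℕ => ((m : ℝ) + 1) * Real.exp (-c * K m) := by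
  obtain ⟨C, hC, hKC⟩ := hK.exists_pos
  have hx : Tendsto (fun m : ℕ => (m : ℝ) ^ (2 / 5 : ℝ)) atTop atTop :=
    (tendsto_rpow_atTop (by norm_num)).comp tendsto_natCast_atTop_atTop
  have h1 : (fun m : ℕ => Real.exp (-c * K m)) =O[atTop]
      fun m : ℕ => Real.exp (-(c / C) * (m : ℝ) ^ (2 / 5 : ℝ)) := by
    refine IsBigO.of_bound 1 ?_
    filter_upwards [hKC.bound] with m hm
    rw [Real.norm_of_nonneg (Real.exp_pos _).le, Real.norm_of_nonneg (Real.exp_pos _).le, one_mul,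
      Real.exp_le_exp]
    rw [Real.norm_of_nonneg (by positivity), Real.norm_of_nonneg (by positivity)] at hm
    have : c / C * (m : ℝ) ^ (2 / 5 : ℝ) ≤ c / C * (C * K m) :=
      mul_le_mul_of_nonneg_left hm (by positivity)
    have h2 : c / C * (C * K m) = c * K m := by field_simp
    linarith
  have h2 : (fun m : ℕ => Real.exp (-(c / C) * (m : ℝ) ^ (2 / 5 : ℝ))) =O[atTop]
      fun m : ℕ => (m : ℝ) ^ (-3 : ℝ) := by
    -- The exponent is chosen so that `(2/5) * (-15/2) = -3`, which leaves `m ^ (-2)` after the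
    -- factor `m + 1`.
    have := ((isLittleO_exp_neg_mul_rpow_atTop (div_pos hc hC) (-(15 / 2))).comp_tendsto hx).isBigO
    refine this.congr (fun m => rfl) fun m => ?_
    simp only [Function.comp_apply]
    rw [← Real.rpow_mul (Nat.cast_nonneg m)]
    norm_num
  have h3 : (fun m : ℕ => (m : ℝ) + 1) =O[atTop] fun m : ℕ => (m : ℝ) := by
    refine IsBigO.of_bound 2 ?_
    filter_upwards [eventually_ge_atTop 1] with m hm
    have : (1 : ℝ) ≤ m := by exact_mod_cast hm
    rw [Real.norm_of_nonneg (by positivity), Real.norm_of_nonneg (by positivity)]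
    linarith
  refine summable_of_isBigO_nat (g := fun m : ℕ => (m : ℝ) ^ (-2 : ℝ))
    (Real.summable_nat_rpow.2 (by norm_num)) ?_
  refine (h3.mul (h1.trans h2)).congr' EventuallyEq.rfl ?_
  filter_upwards [eventually_gt_atTop 0] with m hm
  have : (0 : ℝ) < m := by exact_mod_cast hm
  nth_rewrite 1 [← Real.rpow_one (m : ℝ)]
  rw [← Real.rpow_add this]
  norm_num

lemma ae_eventually_notMem_of_summable {Ω : Type*} [MeasurableSpace Ω] {μ : Measure Ω}
    {s : ℕ → Set Ω} {b : ℕ → ℝ} (hb : Summable b) (h : ∀ᶠ m in atTop, μ (s m) ≤ .ofReal (b m)) :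
    ∀ᵐ ω ∂μ, ∀ᶠ m in atTop, ω ∉ s m := by
  obtain ⟨M, hM⟩ := eventually_atTop.1 h
  -- The bound holds only from `M` on, so the earlier events are replaced by empty ones.
  have hle : ∀ m, μ {ω | M ≤ m ∧ ω ∈ s m} ≤ .ofReal (b m) := by
    intro m
    by_cases hm : M ≤ m
    · simpa [hm] using hM m hm
    · simp [hm]
  have := ae_eventually_notMem (μ := μ) (s := fun m => {ω | M ≤ m ∧ ω ∈ s m})
    (ne_top_of_le_ne_top hb.tsum_ofReal_ne_top (ENNReal.tsum_le_tsum hle))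
  filter_upwards [this] with ω hω
  filter_upwards [hω, eventually_ge_atTop M] with m hm hMm hs using hm ⟨hMm, hs⟩

lemma ae_eventually_ballCount_notMem {Ω E : Type*} [MeasurableSpace Ω] {μ : Measure Ω}
    [IsProbabilityMeasure μ] [PseudoMetricSpace E] {X : ℕ → Ω → E} {η : E} {J : ℕ → Finset ℕ}
    {T : ℕ → Set ℕ} {r b : ℕ → ℝ} (hb : Summable b)
    (h : ∀ᶠ m in atTop, μ.real {ω | ballCount (fun j => X j ω) (J m) η (r m) ∈ T m} ≤ b m) :
    ∀ᵐ ω ∂μ, ∀ᶠ m in atTop, ballCount (fun j => X j ω) (J m) η (r m) ∉ T m := by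
  refine ae_eventually_notMem_of_summable (s := fun m =>
    {ω | ballCount (fun j => X j ω) (J m) η (r m) ∈ T m}) hb ?_
  filter_upwards [h] with m hm
  exact (ENNReal.le_ofReal_iff_toReal_le (measure_ne_top _ _) (measureReal_nonneg.trans hm)).2 hm

/-- The fraction of sample points in `A`, with the normalisation used by `LPE.score`. -/
noncomputable def frequency {E : Type*} (x : ℕ → E) (A : Set E) (m : ℕ) : ℝ :=
  (1 / (m : ℝ)) * ∑ i ∈ Finset.range (m + 1), A.indicator (fun _ => (1 : ℝ)) (x i)

lemma frequency_mono {E : Type*} (x : ℕ → E) {A B : Set E} (h : A ⊆ B) (m : ℕ) :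
    frequency x A m ≤ frequency x B m :=
  mul_le_mul_of_nonneg_left (Finset.sum_le_sum fun _ _ =>
    Set.indicator_le_indicator_of_subset h (fun _ => zero_le_one) _) (by positivity)

section Sample

variable {Ω E : Type*} [MeasurableSpace Ω] {μ : Measure Ω} [IsProbabilityMeasure μ]
  [MeasurableSpace E] {P : Measure E} {X : ℕ → Ω → E}

/-- A union bound over the `m + 1` centres accounts for the factor in `hb`; deleting the centre
leaves exactly `m` points. -/
lemma ae_eventually_forall_ballCount_notMem [PseudoMetricSpace E] [OpensMeasurableSpace E]
    [SecondCountableTopology E] (hX : ∀ i, Measurable (X i)) (hind : iIndepFun X μ)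
    {D : ℕ → Set E} (hD : ∀ m, MeasurableSet (D m)) {T : ℕ → Set ℕ} {r b : ℕ → ℝ}
    (hb : Summable fun m : ℕ => ((m : ℝ) + 1) * b m)
    (h : ∀ᶠ m in atTop, ∀ y ∈ D m, ∀ J : Finset ℕ, J.card = m →
      μ.real {ω | ballCount (fun j => X j ω) J y (r m) ∈ T m} ≤ b m) :
    ∀ᵐ ω ∂μ, ∀ᶠ m in atTop, ∀ i ∈ Finset.range (m + 1), X i ω ∈ D m →
      ballCount (fun j => X j ω) ((Finset.range (m + 1)).erase i) (X i ω) (r m) ∉ T m := by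
  have := ae_eventually_notMem_of_summable (μ := μ) (s := fun m => ⋃ i ∈ Finset.range (m + 1),
    {ω | X i ω ∈ D m ∧
      ballCount (fun j => X j ω) ((Finset.range (m + 1)).erase i) (X i ω) (r m) ∈ T m}) hb ?_
  · filter_upwards [this] with ω hω
    filter_upwards [hω] with m hm i hi hiD hT
    exact hm (Set.mem_biUnion hi ⟨hiD, hT⟩)
  filter_upwards [h] with m hm
  refine (measure_biUnion_finset_le _ _).trans ?_
  have hterm : ∀ i ∈ Finset.range (m + 1), μ {ω | X i ω ∈ D m ∧
      ballCount (fun j => X j ω) ((Finset.range (m + 1)).erase i) (X i ω) (r m) ∈ T m}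
      ≤ .ofReal (b m) := by
    intro i hi
    refine measure_mem_and_ballCount_le hX hind (hD m) (T m) (r m) (Finset.notMem_erase _ _) ?_
    intro y hy
    refine ENNReal.le_ofReal_iff_toReal_le (measure_ne_top _ _) ?_ |>.2 ?_
    -- Only `0 ≤ b m` is extracted here; any `m` indices would do.
    · exact measureReal_nonneg.trans (hm y hy (Finset.range m) (by simp))
    · exact hm y hy _ (by simp [Finset.card_erase_of_mem hi])
  refine (Finset.sum_le_card_nsmul _ _ _ hterm).trans_eq ?_
  rw [Finset.card_range, nsmul_eq_mul, ENNReal.ofReal_mul (by positivity)]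
  congr 1
  rw [← Nat.cast_succ, ENNReal.ofReal_natCast]

lemma ae_tendsto_frequency (hX : ∀ i, Measurable (X i)) (hind : iIndepFun X μ)
    (hP : ∀ i, μ.map (X i) = P) {A : Set E} (hA : MeasurableSet A) :
    ∀ᵐ ω ∂μ, Tendsto (frequency (fun i => X i ω) A) atTop (𝓝 (P.real A)) := by
  have hm : Measurable (A.indicator (fun _ => (1 : ℝ))) := measurable_const.indicator hA
  have h := strong_law_ae_real (μ := μ) (fun i => A.indicator (fun _ => (1 : ℝ)) ∘ X i) ?_ ?_ ?_
  · filter_upwards [h] with ω hω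
    have hint : ∫ ω, (A.indicator (fun _ => (1 : ℝ)) ∘ X 0) ω ∂μ = P.real A := by
      have : A.indicator (fun _ => (1 : ℝ)) ∘ X 0 = (X 0 ⁻¹' A).indicator fun _ => 1 := rfl
      rw [this, integral_indicator_const _ (hX 0 hA), ← hP 0, map_measureReal_apply (hX 0) hA]
      simp
    rw [hint] at hω
    -- Corrects for dividing a sum of `m + 1` terms by `m`.
    have h1 : Tendsto (fun m : ℕ => ((m : ℝ) + 1) / m) atTop (𝓝 1) := by
      have h0 : Tendsto (fun m : ℕ => 1 + 1 / (m : ℝ)) atTop (𝓝 (1 + 0)) :=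
        tendsto_const_nhds.add tendsto_one_div_atTop_nhds_zero_nat
      rw [add_zero] at h0
      refine h0.congr' ?_
      filter_upwards [eventually_gt_atTop 0] with m hm0
      have : (0 : ℝ) < m := by exact_mod_cast hm0
      field_simp
    have h2 := h1.mul ((tendsto_add_atTop_iff_nat 1).2 hω)
    rw [one_mul] at h2
    refine h2.congr fun m => ?_
    simp only [frequency, Function.comp_apply]
    push_cast
    field_simp
  · exact (integrable_const (1 : ℝ)).indicator (hX 0 hA)
  · intro i j hij
    exact (hind.indepFun hij).comp hm hm
  · intro i
    refine IdentDistrib.comp ⟨(hX i).aemeasurable, (hX 0).aemeasurable, ?_⟩ hm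
    rw [hP i, hP 0]

/-- The strong law needs a fixed set: `D m` is enlarged to the tail union `S M`, whose mass
decreases to that of the limsup. -/
lemma ae_eventually_frequency_lt [IsFiniteMeasure P] (hX : ∀ i, Measurable (X i))
    (hind : iIndepFun X μ) (hP : ∀ i, μ.map (X i) = P) {D : ℕ → Set E}
    (hD : ∀ m, MeasurableSet (D m)) {t : ℝ} (ht : P.real {x | ∃ᶠ m in atTop, x ∈ D m} < t) :
    ∀ᵐ ω ∂μ, ∀ᶠ m in atTop, frequency (fun i => X i ω) (D m) m < t := by
  let S : ℕ → Set E := fun M => ⋃ m ≥ M, D m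
  have hS : ∀ M, MeasurableSet (S M) := fun M =>
    MeasurableSet.biUnion (Set.to_countable _) fun m _ => hD m
  have hanti : Antitone S := fun M N hMN => Set.biUnion_subset_biUnion_left fun m hm => hMN.trans hm
  have hlim : ⋂ M, S M = {x | ∃ᶠ m in atTop, x ∈ D m} := by
    ext x
    simp [S, frequently_atTop]
  have hconv := (ENNReal.tendsto_toReal (measure_ne_top P _)).comp (tendsto_measure_iInter_atTop
    (μ := P) (fun M => (hS M).nullMeasurableSet) hanti ⟨0, measure_ne_top _ _⟩)
  rw [hlim] at hconv
  obtain ⟨M, hM⟩ := (hconv.eventually (gt_mem_nhds ht)).exists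
  filter_upwards [ae_tendsto_frequency hX hind hP (hS M)] with ω hω
  filter_upwards [hω.eventually (gt_mem_nhds hM), eventually_ge_atTop M] with m hm hMm
  exact (frequency_mono _ (Set.subset_biUnion_of_mem (u := D) hMm) m).trans_lt hm

/-- Dual argument: tail intersections increase to the liminf. -/
lemma ae_eventually_lt_frequency [IsFiniteMeasure P] (hX : ∀ i, Measurable (X i))
    (hind : iIndepFun X μ) (hP : ∀ i, μ.map (X i) = P) {D : ℕ → Set E}
    (hD : ∀ m, MeasurableSet (D m)) {t : ℝ} (ht : t < P.real {x | ∀ᶠ m in atTop, x ∈ D m}) :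
    ∀ᵐ ω ∂μ, ∀ᶠ m in atTop, t < frequency (fun i => X i ω) (D m) m := by
  let S : ℕ → Set E := fun M => ⋂ m ≥ M, D m
  have hS : ∀ M, MeasurableSet (S M) := fun M =>
    MeasurableSet.biInter (Set.to_countable _) fun m _ => hD m
  have hmono : Monotone S := fun M N hMN => Set.biInter_subset_biInter_left fun m hm => hMN.trans hm
  have hlim : ⋃ M, S M = {x | ∀ᶠ m in atTop, x ∈ D m} := by
    ext x
    simp [S, eventually_atTop]
  have hconv := (ENNReal.tendsto_toReal (measure_ne_top P _)).comp (tendsto_measure_iUnion_atTop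
    (μ := P) hmono)
  rw [hlim] at hconv
  obtain ⟨M, hM⟩ := (hconv.eventually (lt_mem_nhds ht)).exists
  filter_upwards [ae_tendsto_frequency hX hind hP (hS M)] with ω hω
  filter_upwards [hω.eventually (lt_mem_nhds hM), eventually_ge_atTop M] with m hm hMm
  exact hm.trans_le (frequency_mono _ (Set.biInter_subset_of_mem (t := D) hMm) m)

end Sample

/-! ### Small balls -/

lemma measurable_measureReal_closedBall {E : Type*} [PseudoMetricSpace E] [MeasurableSpace E]
    [OpensMeasurableSpace E] [SecondCountableTopology E] (P : Measure E) [SFinite P] (r : ℝ) :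
    Measurable fun x => P.real (Metric.closedBall x r) := by
  have hs : MeasurableSet {q : E × E | dist q.2 q.1 ≤ r} :=
    measurableSet_le (measurable_snd.dist measurable_fst) measurable_const
  exact (measurable_measure_prodMk_left (ν := P) hs).ennreal_toReal

/-- Balls have volume `w r^d` whatever their centre, so `r = (v / w)^(1/d)` works everywhere at
once. -/
lemma exists_radius {d : ℕ} (hd : d ≠ 0) {v : ℕ → ℝ} (hv : Tendsto v atTop (𝓝 0))
    (hpos : ∀ᶠ m in atTop, 0 < v m) :
    ∃ r : ℕ → ℝ, Tendsto r atTop (𝓝[>] 0) ∧ ∀ᶠ m in atTop, ∀ x : EuclideanSpace ℝ (Fin d),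
      volume.real (Metric.closedBall x (r m)) = v m := by
  set w : ℝ := volume.real (Metric.ball (0 : EuclideanSpace ℝ (Fin d)) 1) with hw
  have hw0 : 0 < w := ENNReal.toReal_pos (Metric.measure_ball_pos _ _ one_pos).ne'
    measure_ball_lt_top.ne
  have hd' : (0 : ℝ) < (d : ℝ)⁻¹ := by positivity
  refine ⟨fun m => (v m / w) ^ (d : ℝ)⁻¹, tendsto_nhdsWithin_iff.2 ⟨?_, ?_⟩, ?_⟩
  · have := (hv.div_const w).rpow_const (p := (d : ℝ)⁻¹) (Or.inr hd'.le)
    rwa [zero_div, Real.zero_rpow hd'.ne'] at this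
  · filter_upwards [hpos] with m hm
    exact Real.rpow_pos_of_pos (div_pos hm hw0) _
  · filter_upwards [hpos] with m hm x
    rw [measureReal_def, Measure.addHaar_closedBall _ _ (by positivity), ENNReal.toReal_mul,
      ← measureReal_def, ← hw, ENNReal.toReal_ofReal (by positivity), finrank_euclideanSpace_fin,
      Real.rpow_inv_natCast_pow (by positivity) hd]
    field_simp

section Density

variable {d : ℕ} {f : EuclideanSpace ℝ (Fin d) → ℝ}

lemma IsCubeDensity.isProbabilityMeasure_law (hf : IsCubeDensity f) :
    IsProbabilityMeasure (law f) :=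
  ⟨by rw [law, withDensity_apply _ MeasurableSet.univ, Measure.restrict_univ, hf.lintegral_eq_one]⟩

lemma volumeReal_closedBall_pos (x : EuclideanSpace ℝ (Fin d)) {r : ℝ} (hr : 0 < r) :
    0 < volume.real (Metric.closedBall x r) :=
  ENNReal.toReal_pos (Metric.measure_closedBall_pos _ _ hr).ne' measure_closedBall_lt_top.ne

lemma IsCubeDensity.ae_tendsto_law_closedBall (hf : IsCubeDensity f) :
    ∀ᵐ x ∂(law f), Tendsto (fun r => (law f).real (Metric.closedBall x r) /
      volume.real (Metric.closedBall x r)) (𝓝[>] 0) (𝓝 (f x)) := by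
  have := hf.isProbabilityMeasure_law
  have hac : law f ≪ volume := withDensity_absolutelyContinuous _ _
  refine hac.ae_le ?_
  filter_upwards [Besicovitch.ae_tendsto_rnDeriv (law f) volume,
    Measure.rnDeriv_withDensity volume hf.measurable.ennreal_ofReal] with x hx hx'
  have hx'' : (∂(law f)/∂volume) x = ENNReal.ofReal (f x) := hx'
  rw [hx''] at hx
  have h := (ENNReal.tendsto_toReal ENNReal.ofReal_ne_top).comp hx
  rw [ENNReal.toReal_ofReal (hf.nonneg x)] at h
  exact h.congr fun r => by simp [measureReal_def]

/-- Almost-everywhere differentiation says nothing at a prescribed point; continuity fills the gap.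
-/
lemma law_closedBall_tendsto_of_continuousAt (hf : IsCubeDensity f)
    {η : EuclideanSpace ℝ (Fin d)} (hη : ContinuousAt f η) :
    Tendsto (fun r => (law f).real (Metric.closedBall η r) /
      volume.real (Metric.closedBall η r)) (𝓝[>] 0) (𝓝 (f η)) := by
  have := hf.isProbabilityMeasure_law
  have hball : ∀ p : EuclideanSpace ℝ (Fin d) → Prop, (∀ᶠ x in 𝓝 η, p x) →
      ∀ᶠ r in 𝓝[>] (0 : ℝ), 0 < r ∧ ∀ x ∈ Metric.closedBall η r, p x := by
    intro p hp
    obtain ⟨ε, hε, h⟩ := Metric.eventually_nhds_iff_ball.1 hp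
    filter_upwards [Ioo_mem_nhdsGT hε] with r hr
    exact ⟨hr.1, fun x hx => h x (Metric.closedBall_subset_ball hr.2 hx)⟩
  have hmeas : ∀ r, law f (Metric.closedBall η r) =
      ∫⁻ x in Metric.closedBall η r, ENNReal.ofReal (f x) := fun r =>
    withDensity_apply _ Metric.isClosed_closedBall.measurableSet
  refine tendsto_order.2 ⟨fun w hw => ?_, fun w hw => ?_⟩
  · obtain ⟨w', hww', hw'⟩ := exists_between hw
    filter_upwards [hball _ (hη.eventually (lt_mem_nhds hw'))] with r hr
    refine hww'.trans_le ?_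
    rw [le_div_iff₀ (volumeReal_closedBall_pos η hr.1)]
    -- `ENNReal.ofReal` truncates negative values, so this case is separate.
    by_cases h0 : w' ≤ 0
    · exact (mul_nonpos_of_nonpos_of_nonneg h0 measureReal_nonneg).trans measureReal_nonneg
    have hle : ENNReal.ofReal w' * volume (Metric.closedBall η r)
        ≤ law f (Metric.closedBall η r) := by
      rw [hmeas, ← setLIntegral_const]
      exact setLIntegral_mono' Metric.isClosed_closedBall.measurableSet
        fun x hx => ENNReal.ofReal_le_ofReal (hr.2 x hx).le
    have := ENNReal.toReal_mono (measure_ne_top _ _) hle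
    rwa [ENNReal.toReal_mul, ENNReal.toReal_ofReal (not_le.1 h0).le] at this
  · obtain ⟨w', hw', hww'⟩ := exists_between hw
    filter_upwards [hball _ (hη.eventually (gt_mem_nhds hw'))] with r hr
    refine lt_of_le_of_lt ?_ hww'
    rw [div_le_iff₀ (volumeReal_closedBall_pos η hr.1)]
    have h0 : 0 ≤ w' := (hf.nonneg η).trans hw'.le
    have hle : law f (Metric.closedBall η r)
        ≤ ENNReal.ofReal w' * volume (Metric.closedBall η r) := by
      rw [hmeas, ← setLIntegral_const]
      exact setLIntegral_mono' Metric.isClosed_closedBall.measurableSet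
        fun x hx => ENNReal.ofReal_le_ofReal (hr.2 x hx).le
    have := ENNReal.toReal_mono
      (ENNReal.mul_ne_top ENNReal.ofReal_ne_top measure_closedBall_lt_top.ne) hle
    rwa [ENNReal.toReal_mul, ENNReal.toReal_ofReal h0] at this

end Density

/-! ### Comparing the score with frequencies -/

section Score

variable {d : ℕ} {K m : ℕ} {x : ℕ → EuclideanSpace ℝ (Fin d)} {η : EuclideanSpace ℝ (Fin d)}
  {r : ℝ} {D : Set (EuclideanSpace ℝ (Fin d))}

lemma card_range_succ_erase {i : ℕ} (hi : i ∈ Finset.range (m + 1)) :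
    ((Finset.range (m + 1)).erase i).card = m := by
  simp [Finset.card_erase_of_mem hi]

lemma card_Ioc_two_mul : (Finset.Ioc m (2 * m)).card = m := by
  rw [Nat.card_Ioc]; omega

/-- The radius separates the distances: that of `η` exceeds `r`, that of each sample point in `D`
does not. -/
lemma score_le_frequency_compl (hr : 0 ≤ r) (hK : K ≤ m)
    (hη : ballCount x (Finset.Ioc m (2 * m)) η r < K)
    (hD : ∀ i ∈ Finset.range (m + 1), x i ∈ D →
      K ≤ ballCount x ((Finset.range (m + 1)).erase i) (x i) r) :
    score K m x η ≤ frequency x Dᶜ m := by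
  refine mul_le_mul_of_nonneg_left (Finset.sum_le_sum fun i hi => ?_) (by positivity)
  by_cases hi' : x i ∈ D
  · rw [Set.indicator_of_notMem]
    · exact Set.indicator_nonneg (fun _ _ => zero_le_one) _
    · intro h
      refine absurd hη (not_lt.2 ((knnDist_le_iff hr (hK.trans_eq card_Ioc_two_mul.symm)).1 ?_))
      exact (Set.mem_ofPred.1 h).trans ((knnDist_le_iff hr
        (hK.trans_eq (card_range_succ_erase hi).symm)).2 (hD i hi hi'))
  · rw [Set.indicator_of_mem (Set.mem_compl hi')]
    exact Set.indicator_le_self' (f := fun _ => (1 : ℝ)) (fun _ _ => zero_le_one) _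

lemma frequency_le_score (hr : 0 ≤ r) (hK : K ≤ m)
    (hη : K ≤ ballCount x (Finset.Ioc m (2 * m)) η r)
    (hD : ∀ i ∈ Finset.range (m + 1), x i ∈ D →
      ballCount x ((Finset.range (m + 1)).erase i) (x i) r < K) :
    frequency x D m ≤ score K m x η := by
  refine mul_le_mul_of_nonneg_left (Finset.sum_le_sum fun i hi => ?_) (by positivity)
  by_cases hi' : x i ∈ D
  · rw [Set.indicator_of_mem hi', Set.indicator_of_mem]
    have h1 := (knnDist_le_iff hr (hK.trans_eq card_Ioc_two_mul.symm)).2 hη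
    have h2 := mt (knnDist_le_iff hr (hK.trans_eq (card_range_succ_erase hi).symm)).1
      (not_le.2 (hD i hi hi'))
    exact h1.trans (not_le.1 h2).le
  · rw [Set.indicator_of_notMem hi']
    exact Set.indicator_nonneg (fun _ _ => zero_le_one) _

end Score

/-! ### Growth of the number of neighbours -/

section Growth

variable {K : ℕ → ℕ}
lemma eventually_neighbours_pos
    (hK : (fun m => (K m : ℝ)) =Θ[atTop] fun m : ℕ => (m : ℝ) ^ (2 / 5 : ℝ)) :
    ∀ᶠ m in atTop, 0 < K m := by
  obtain ⟨C, hC⟩ := hK.2.bound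
  filter_upwards [hC, eventually_gt_atTop 0] with m hm h0
  by_contra! h
  have hx : (0 : ℝ) < (m : ℝ) ^ (2 / 5 : ℝ) := Real.rpow_pos_of_pos (by exact_mod_cast h0) _
  rw [Nat.le_zero.1 h, Real.norm_of_nonneg hx.le] at hm
  simp at hm
  linarith

lemma tendsto_neighbours_div
    (hK : (fun m => (K m : ℝ)) =Θ[atTop] fun m : ℕ => (m : ℝ) ^ (2 / 5 : ℝ)) :
    Tendsto (fun m : ℕ => (K m : ℝ) / m) atTop (𝓝 0) := by
  have ho : Tendsto (fun m : ℕ => (m : ℝ) ^ (2 / 5 : ℝ) / m) atTop (𝓝 0) := by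
    refine ((tendsto_rpow_neg_atTop (y := 3 / 5) (by norm_num)).comp
      tendsto_natCast_atTop_atTop).congr' ?_
    filter_upwards [eventually_gt_atTop 0] with m hm
    have hm' : (0 : ℝ) < m := by exact_mod_cast hm
    rw [Function.comp_apply, eq_div_iff hm'.ne']
    nth_rewrite 2 [← Real.rpow_one (m : ℝ)]
    rw [← Real.rpow_add hm']
    norm_num
  exact (hK.1.mul (isBigO_refl (fun m : ℕ => (m : ℝ)⁻¹) atTop)).trans_tendsto ho

lemma eventually_neighbours_le
    (hK : (fun m => (K m : ℝ)) =Θ[atTop] fun m : ℕ => (m : ℝ) ^ (2 / 5 : ℝ)) :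
    ∀ᶠ m in atTop, K m ≤ m := by
  filter_upwards [(tendsto_neighbours_div hK).eventually (gt_mem_nhds one_pos),
    eventually_gt_atTop 0] with m hm h0
  rw [div_lt_one (by exact_mod_cast h0)] at hm
  exact_mod_cast hm.le

end Growth

/-! ### One-sided almost sure bounds for the score -/

section Bounds

variable {d : ℕ} {Ω : Type*} [MeasurableSpace Ω] {μ : Measure Ω} [IsProbabilityMeasure μ]
  {f : EuclideanSpace ℝ (Fin d) → ℝ} {X : ℕ → Ω → EuclideanSpace ℝ (Fin d)} {K : ℕ → ℕ}
  {η : EuclideanSpace ℝ (Fin d)}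

/-- Here `k / m / u` stands for the ball's volume: average density at most `w` gives expected count
at most `(w / u) k`, so Chernoff applies with `θ = w / u`. -/
lemma exists_exp_bound_le_ballCount (hX : ∀ i, Measurable (X i)) (hind : iIndepFun X μ)
    (hP : ∀ i, μ.map (X i) = law f) {w u : ℝ} (hw : 0 ≤ w) (hwu : w < u) :
    ∃ c > 0, ∀ (m k : ℕ) (J : Finset ℕ) (y : EuclideanSpace ℝ (Fin d)) (r : ℝ), 0 < m →
      J.card = m → (law f).real (Metric.closedBall y r) ≤ w * (k / m / u) →
      μ.real {ω | ballCount (fun j => X j ω) J y r ∈ {n | k ≤ n}} ≤ Real.exp (-c * k) := by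
  obtain ⟨c, hc, h⟩ := measureReal_le_sum_indicator_le hX hind hP (θ := w / u)
    (div_nonneg hw (hw.trans hwu.le)) ((div_lt_one (hw.trans_lt hwu)).2 hwu)
  refine ⟨c, hc, fun m k J y r hm hJ hle => ?_⟩
  have hm' : (0 : ℝ) < m := by exact_mod_cast hm
  refine le_trans (le_of_eq ?_) (h (Metric.closedBall y r) J k
    Metric.isClosed_closedBall.measurableSet (Nat.cast_nonneg k) ?_)
  · simp only [← ballCount_eq_sum_indicator, Nat.cast_le, Set.mem_ofPred_eq]
  · rw [hJ]
    refine (mul_le_mul_of_nonneg_left hle hm'.le).trans_eq ?_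
    field_simp

lemma exists_exp_bound_ballCount_lt (hX : ∀ i, Measurable (X i)) (hind : iIndepFun X μ)
    (hP : ∀ i, μ.map (X i) = law f) {w u : ℝ} (hu : 0 < u) (huw : u < w) :
    ∃ c > 0, ∀ (m k : ℕ) (J : Finset ℕ) (y : EuclideanSpace ℝ (Fin d)) (r : ℝ), 0 < m →
      J.card = m → w * (k / m / u) ≤ (law f).real (Metric.closedBall y r) →
      μ.real {ω | ballCount (fun j => X j ω) J y r ∈ {n | n < k}} ≤ Real.exp (-c * k) := by
  obtain ⟨c, hc, h⟩ := measureReal_sum_indicator_le_le hX hind hP (θ := w / u)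
    ((one_lt_div hu).2 huw)
  refine ⟨c, hc, fun m k J y r hm hJ hle => ?_⟩
  have hm' : (0 : ℝ) < m := by exact_mod_cast hm
  refine le_trans (measureReal_mono ?_) (h (Metric.closedBall y r) J k
    Metric.isClosed_closedBall.measurableSet (Nat.cast_nonneg k) ?_)
  · intro ω hω
    simp only [← ballCount_eq_sum_indicator, Nat.cast_le, Set.mem_ofPred_eq] at hω ⊢
    exact hω.le
  · rw [hJ]
    refine le_trans (le_of_eq ?_) (mul_le_mul_of_nonneg_left hle hm'.le)
    field_simp

lemma exists_radius_neighbours (hd : d ≠ 0)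
    (hK : (fun m => (K m : ℝ)) =Θ[atTop] fun m : ℕ => (m : ℝ) ^ (2 / 5 : ℝ)) {u : ℝ}
    (hu : 0 < u) :
    ∃ r : ℕ → ℝ, Tendsto r atTop (𝓝[>] 0) ∧ ∀ᶠ m in atTop, ∀ x : EuclideanSpace ℝ (Fin d),
      volume.real (Metric.closedBall x (r m)) = K m / m / u := by
  refine exists_radius hd ?_ ?_
  · simpa using (tendsto_neighbours_div hK).div_const u
  · filter_upwards [eventually_neighbours_pos hK, eventually_gt_atTop 0] with m h1 h2
    have h1' : (0 : ℝ) < K m := by exact_mod_cast h1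
    have h2' : (0 : ℝ) < m := by exact_mod_cast h2
    positivity

lemma ae_eventually_score_lt (hd : d ≠ 0) (hf : IsCubeDensity f) (hX : ∀ i, Measurable (X i))
    (hind : iIndepFun X μ) (hP : ∀ i, μ.map (X i) = law f)
    (hK : (fun m => (K m : ℝ)) =Θ[atTop] fun m : ℕ => (m : ℝ) ^ (2 / 5 : ℝ))
    (hη : ContinuousAt f η) {w : ℝ} (hw : f η < w) {t : ℝ} (ht : (law f).real {x | f x ≤ w} < t) :
    ∀ᵐ ω ∂μ, ∀ᶠ m in atTop, score (K m) m (fun i => X i ω) η < t := by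
  have := hf.isProbabilityMeasure_law
  -- In `f η < v < u < w`, the level `u` fixes the radius, `v < u` leaves a deficit of points around
  -- `η`, and `w > u` a surplus around points of `D m`.
  obtain ⟨u, hηu, huw⟩ := exists_between hw
  obtain ⟨v, hηv, hvu⟩ := exists_between hηu
  have hv : 0 ≤ v := (hf.nonneg η).trans hηv.le
  obtain ⟨r, hr, hvol⟩ := exists_radius_neighbours hd hK (hv.trans_lt hvu)
  have hr0 : ∀ᶠ m in atTop, 0 < r m := hr.eventually self_mem_nhdsWithin
  obtain ⟨c₁, hc₁, hη₁⟩ := exists_exp_bound_le_ballCount hX hind hP hv hvu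
  obtain ⟨c₂, hc₂, hD₂⟩ := exists_exp_bound_ballCount_lt hX hind hP (hv.trans_lt hvu) huw
  let D : ℕ → Set (EuclideanSpace ℝ (Fin d)) := fun m =>
    {x | w * (K m / m / u) ≤ (law f).real (Metric.closedBall x (r m))}
  have hD : ∀ m, MeasurableSet (D m) := fun m =>
    measurableSet_le measurable_const (measurable_measureReal_closedBall _ _)
  -- If `f x > w`, differentiation eventually puts `x` in `D m`; so almost every `x` that is
  -- infinitely often outside has `f x ≤ w`.
  have hlim : (law f).real {x | ∃ᶠ m in atTop, x ∈ (D m)ᶜ} < t := by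
    refine lt_of_le_of_lt (ENNReal.toReal_mono (measure_ne_top _ _) (measure_mono_ae ?_)) ht
    filter_upwards [hf.ae_tendsto_law_closedBall] with x hx hxD
    by_contra hxw
    refine hxD ?_
    filter_upwards [(hx.comp hr).eventually (lt_mem_nhds (not_le.1 hxw)), hvol, hr0]
      with m hm hm' hrm hmem
    refine hmem ?_
    have hpos := volumeReal_closedBall_pos x hrm
    rw [Function.comp_apply, lt_div_iff₀ hpos, hm' x] at hm
    exact hm.le
  have hS₂ := ae_eventually_ballCount_notMem (μ := μ) (X := X) (η := η)
    (J := fun m => Finset.Ioc m (2 * m)) (T := fun m => {n | K m ≤ n}) (r := r)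
    (b := fun m => Real.exp (-c₁ * K m)) ?_ ?_
  · have hS₁ := ae_eventually_forall_ballCount_notMem hX hind hD (T := fun m => {n | n < K m})
      (r := r) (b := fun m => Real.exp (-c₂ * K m)) (summable_succ_mul_exp_neg hK.2 hc₂) ?_
    · filter_upwards [hS₁, hS₂, ae_eventually_frequency_lt hX hind hP (fun m => (hD m).compl) hlim]
        with ω h₁ h₂ h₃
      filter_upwards [h₁, h₂, h₃, hr0, eventually_neighbours_le hK] with m h₁ h₂ h₃ hrm hKm
      refine (score_le_frequency_compl hrm.le hKm (not_le.1 h₂) (D := D m) ?_).trans_lt h₃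
      intro i hi hiD
      exact not_lt.1 (h₁ i hi hiD)
    · filter_upwards [eventually_gt_atTop 0] with m hm y hy J hJ
      exact hD₂ m (K m) J y (r m) hm hJ hy
  · refine (summable_succ_mul_exp_neg hK.2 hc₁).of_nonneg_of_le (fun m => (Real.exp_pos _).le)
      fun m => le_mul_of_one_le_left (Real.exp_pos _).le (by simp)
  · have hlaw := (law_closedBall_tendsto_of_continuousAt hf hη).comp hr
    filter_upwards [hlaw.eventually (gt_mem_nhds hηv), hvol, hr0, eventually_gt_atTop 0]
      with m hm hm' hrm hm0
    refine hη₁ m (K m) _ η (r m) hm0 card_Ioc_two_mul ?_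
    rw [Function.comp_apply, div_lt_iff₀ (volumeReal_closedBall_pos η hrm), hm' η] at hm
    exact hm.le

lemma ae_eventually_lt_score (hd : d ≠ 0) (hf : IsCubeDensity f) (hX : ∀ i, Measurable (X i))
    (hind : iIndepFun X μ) (hP : ∀ i, μ.map (X i) = law f)
    (hK : (fun m => (K m : ℝ)) =Θ[atTop] fun m : ℕ => (m : ℝ) ^ (2 / 5 : ℝ))
    (hη : ContinuousAt f η) {w : ℝ} (hw0 : 0 ≤ w) (hw : w < f η) {t : ℝ}
    (ht : t < (law f).real {x | f x < w}) :
    ∀ᵐ ω ∂μ, ∀ᶠ m in atTop, t < score (K m) m (fun i => X i ω) η := by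
  have := hf.isProbabilityMeasure_law
  -- Now `w < u < v < f η`: a surplus around `η`, a deficit around points of `D m`.
  obtain ⟨u, hwu, huη⟩ := exists_between hw
  obtain ⟨v, huv, hvη⟩ := exists_between huη
  have hu : 0 < u := hw0.trans_lt hwu
  obtain ⟨r, hr, hvol⟩ := exists_radius_neighbours hd hK hu
  have hr0 : ∀ᶠ m in atTop, 0 < r m := hr.eventually self_mem_nhdsWithin
  obtain ⟨c₁, hc₁, hη₁⟩ := exists_exp_bound_ballCount_lt hX hind hP hu huv
  obtain ⟨c₂, hc₂, hD₂⟩ := exists_exp_bound_le_ballCount hX hind hP hw0 hwu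
  let D : ℕ → Set (EuclideanSpace ℝ (Fin d)) := fun m =>
    {x | (law f).real (Metric.closedBall x (r m)) ≤ w * (K m / m / u)}
  have hD : ∀ m, MeasurableSet (D m) := fun m =>
    measurableSet_le (measurable_measureReal_closedBall _ _) measurable_const
  have hlim : t < (law f).real {x | ∀ᶠ m in atTop, x ∈ D m} := by
    refine ht.trans_le (ENNReal.toReal_mono (measure_ne_top _ _) (measure_mono_ae ?_))
    filter_upwards [hf.ae_tendsto_law_closedBall] with x hx hxw
    show ∀ᶠ m in atTop, x ∈ D m
    filter_upwards [(hx.comp hr).eventually (gt_mem_nhds hxw), hvol, hr0] with m hm hm' hrm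
    have hpos := volumeReal_closedBall_pos x hrm
    rw [Function.comp_apply, div_lt_iff₀ hpos, hm' x] at hm
    exact hm.le
  have hS₂ := ae_eventually_ballCount_notMem (μ := μ) (X := X) (η := η)
    (J := fun m => Finset.Ioc m (2 * m)) (T := fun m => {n | n < K m}) (r := r)
    (b := fun m => Real.exp (-c₁ * K m)) ?_ ?_
  · have hS₁ := ae_eventually_forall_ballCount_notMem hX hind hD (T := fun m => {n | K m ≤ n})
      (r := r) (b := fun m => Real.exp (-c₂ * K m)) (summable_succ_mul_exp_neg hK.2 hc₂) ?_
    · filter_upwards [hS₁, hS₂, ae_eventually_lt_frequency hX hind hP hD hlim] with ω h₁ h₂ h₃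
      filter_upwards [h₁, h₂, h₃, hr0, eventually_neighbours_le hK] with m h₁ h₂ h₃ hrm hKm
      refine h₃.trans_le (frequency_le_score hrm.le hKm (not_lt.1 h₂) (D := D m) ?_)
      intro i hi hiD
      exact not_le.1 (h₁ i hi hiD)
    · filter_upwards [eventually_gt_atTop 0] with m hm y hy J hJ
      exact hD₂ m (K m) J y (r m) hm hJ hy
  · refine (summable_succ_mul_exp_neg hK.2 hc₁).of_nonneg_of_le (fun m => (Real.exp_pos _).le)
      fun m => le_mul_of_one_le_left (Real.exp_pos _).le (by simp)
  · have hlaw := (law_closedBall_tendsto_of_continuousAt hf hη).comp hr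
    filter_upwards [hlaw.eventually (lt_mem_nhds hvη), hvol, hr0, eventually_gt_atTop 0]
      with m hm hm' hrm hm0
    refine hη₁ m (K m) _ η (r m) hm0 card_Ioc_two_mul ?_
    rw [Function.comp_apply, lt_div_iff₀ (volumeReal_closedBall_pos η hrm), hm' η] at hm
    exact hm.le

end Bounds

/-! ### The p-value -/

section PValue

variable {d : ℕ} {f : EuclideanSpace ℝ (Fin d) → ℝ} {η : EuclideanSpace ℝ (Fin d)}

lemma IsCubeDensity.ae_pos (hf : IsCubeDensity f) : ∀ᵐ x ∂(law f), 0 < f x := by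
  rw [law, ae_withDensity_iff hf.measurable.ennreal_ofReal]
  filter_upwards with x hx
  exact ENNReal.ofReal_pos.1 (pos_iff_ne_zero.2 hx)

lemma likelihoodRatio_uniformDensity (hη : η ∈ cube d) :
    likelihoodRatio (uniformDensity d) f η = (ENNReal.ofReal (f η))⁻¹ := by
  simp [likelihoodRatio, uniformDensity, hη]

lemma IsCubeDensity.mem_cube_of_pos (hf : IsCubeDensity f) (h : 0 < f η) : η ∈ cube d := by
  by_contra h'
  exact h.ne' (hf.eq_zero_of_notMem η h')

/-- Almost every point has positive density, hence lies in the cube, where inversion reverses the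
order. -/
lemma IsCubeDensity.pValue_eq (hf : IsCubeDensity f) (hη : η ∈ cube d) :
    pValue (uniformDensity d) f η = (law f).real {x | f x ≤ f η} := by
  refine measureReal_congr ?_
  filter_upwards [hf.ae_pos] with x hx
  refine propext ?_
  show likelihoodRatio _ f η ≤ likelihoodRatio _ f x ↔ f x ≤ f η
  rw [likelihoodRatio_uniformDensity hη,
    likelihoodRatio_uniformDensity (hf.mem_cube_of_pos hx), ENNReal.inv_le_inv,
    ENNReal.ofReal_le_ofReal_iff (hf.nonneg η)]

lemma IsCubeDensity.law_lt_eq_law_le (hf : IsCubeDensity f)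
    (hflat : NoFlatSpots (uniformDensity d) f) (a : ℝ) :
    (law f).real {x | f x < a} = (law f).real {x | f x ≤ a} := by
  refine measureReal_congr ?_
  -- The level set `f = a` is the flat spot of ratio `1 / a`.
  filter_upwards [hf.ae_pos, measure_eq_zero_iff_ae_notMem.1 (hflat (ENNReal.ofReal a)⁻¹)]
    with x hx hxa
  refine propext ⟨fun h => le_of_lt h, fun h => lt_of_le_of_ne h ?_⟩
  rintro rfl
  exact hxa (likelihoodRatio_uniformDensity (hf.mem_cube_of_pos hx))

/-- A one-point space would itself be a flat spot of full mass. -/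
lemma IsCubeDensity.dimension_ne_zero (hf : IsCubeDensity f)
    (hflat : NoFlatSpots (uniformDensity d) f) : d ≠ 0 := by
  rintro rfl
  have := hf.isProbabilityMeasure_law
  have h := hflat (likelihoodRatio (uniformDensity 0) f 0)
  rw [show {x | likelihoodRatio (uniformDensity 0) f x = likelihoodRatio (uniformDensity 0) f 0}
    = Set.univ from Set.eq_univ_of_forall fun x => by rw [Subsingleton.elim x 0]; rfl,
    measure_univ] at h
  exact one_ne_zero h

lemma exists_gt_law_le_lt [IsFiniteMeasure (law f)] (hf : Measurable f) {a t : ℝ}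
    (ht : (law f).real {x | f x ≤ a} < t) : ∃ w > a, (law f).real {x | f x ≤ w} < t := by
  obtain ⟨b, hb, hba, hlim⟩ := exists_seq_strictAnti_tendsto a
  have h := (ENNReal.tendsto_toReal (measure_ne_top (law f) _)).comp
    (tendsto_measure_iInter_atTop (μ := law f) (s := fun n => {x | f x ≤ b n})
      (fun n => (measurableSet_le hf measurable_const).nullMeasurableSet)
      (fun m n hmn x (hx : f x ≤ b n) => hx.trans (hb.antitone hmn)) ⟨0, measure_ne_top _ _⟩)
  have hI : ⋂ n, {x | f x ≤ b n} = {x | f x ≤ a} := by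
    ext x
    simp only [Set.mem_iInter, Set.mem_ofPred_eq]
    exact ⟨fun hx => ge_of_tendsto' hlim hx, fun hx n => hx.trans (hba n).le⟩
  rw [hI] at h
  obtain ⟨n, hn⟩ := (h.eventually (gt_mem_nhds ht)).exists
  exact ⟨b n, hba n, hn⟩

lemma exists_lt_lt_law_lt [IsFiniteMeasure (law f)] {a t : ℝ} (ha : 0 < a)
    (ht : t < (law f).real {x | f x < a}) :
    ∃ w, 0 ≤ w ∧ w < a ∧ t < (law f).real {x | f x < w} := by
  obtain ⟨b, hb, hba, hlim⟩ := exists_seq_strictMono_tendsto' ha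
  have h := (ENNReal.tendsto_toReal (measure_ne_top (law f) _)).comp
    (tendsto_measure_iUnion_atTop (μ := law f) (s := fun n => {x | f x < b n})
      (fun m n hmn x (hx : f x < b m) => hx.trans_le (hb.monotone hmn)))
  have hU : ⋃ n, {x | f x < b n} = {x | f x < a} := by
    ext x
    simp only [Set.mem_iUnion, Set.mem_ofPred_eq]
    exact ⟨fun ⟨n, hn⟩ => hn.trans (hba n).2, fun hx => (hlim.eventually (lt_mem_nhds hx)).exists⟩
  rw [hU] at h
  obtain ⟨n, hn⟩ := (h.eventually (lt_mem_nhds ht)).exists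
  exact ⟨b n, (hba n).1.le, (hba n).2, hn⟩

lemma continuousAt_of_notMem_frontier_support
    (hf : DifferentiableOn ℝ f (interior (Function.support f)))
    (hη : η ∉ frontier (Function.support f)) : ContinuousAt f η := by
  by_cases h : η ∈ interior (Function.support f)
  · exact hf.continuousOn.continuousAt (isOpen_interior.mem_nhds h)
  · have hη' : η ∉ closure (Function.support f) := fun h' => hη ⟨h', h⟩
    have : f =ᶠ[𝓝 η] fun _ => 0 := by
      filter_upwards [isClosed_closure.isOpen_compl.mem_nhds hη'] with x hx
      exact Function.notMem_support.1 fun h' => hx (subset_closure h')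
    exact continuousAt_const.congr this.symm

end PValue

/-! ### Convergence of the score -/

lemma ae_tendsto_score {d : ℕ} {Ω : Type*} [MeasurableSpace Ω] {μ : Measure Ω}
    [IsProbabilityMeasure μ] {f : EuclideanSpace ℝ (Fin d) → ℝ}
    {X : ℕ → Ω → EuclideanSpace ℝ (Fin d)} {K : ℕ → ℕ} {η : EuclideanSpace ℝ (Fin d)}
    (hf : IsCubeDensity f) (hflat : NoFlatSpots (uniformDensity d) f)
    (hX : ∀ i, Measurable (X i)) (hind : iIndepFun X μ) (hP : ∀ i, μ.map (X i) = law f)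
    (hK : (fun m => (K m : ℝ)) =Θ[atTop] fun m : ℕ => (m : ℝ) ^ (2 / 5 : ℝ))
    (hη : ContinuousAt f η) (hηc : η ∈ cube d) :
    ∀ᵐ ω ∂μ, Tendsto (fun m => score (K m) m (fun i => X i ω) η) atTop
      (𝓝 (pValue (uniformDensity d) f η)) := by
  have := hf.isProbabilityMeasure_law
  have hd := hf.dimension_ne_zero hflat
  rw [hf.pValue_eq hηc]
  set p := (law f).real {x | f x ≤ f η} with hp
  -- Countably many levels on each side of `p` allow a single exceptional null set.
  obtain ⟨b, -, hbp, hb⟩ := exists_seq_strictAnti_tendsto p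
  obtain ⟨b', -, hbp', hb'⟩ := exists_seq_strictMono_tendsto p
  have hupper : ∀ n, ∀ᵐ ω ∂μ, ∀ᶠ m in atTop, score (K m) m (fun i => X i ω) η < b n := by
    intro n
    obtain ⟨w, hw, hwt⟩ := exists_gt_law_le_lt hf.measurable (hbp n)
    exact ae_eventually_score_lt hd hf hX hind hP hK hη hw hwt
  have hlower : ∀ n, ∀ᵐ ω ∂μ, ∀ᶠ m in atTop, b' n < score (K m) m (fun i => X i ω) η := by
    intro n
    -- When `f η = 0` no threshold fits in `[0, f η)`, but then `p = 0` and the score is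
    -- nonnegative.
    rcases (hf.nonneg η).eq_or_lt with h0 | h0
    · have hp0 : p = 0 := by
        rw [hp, ← h0, measureReal_def, measure_eq_zero_iff_ae_notMem.2, ENNReal.toReal_zero]
        filter_upwards [hf.ae_pos] with x hx using not_le.2 hx
      filter_upwards with ω
      filter_upwards with m
      refine (hbp' n).trans_le (hp0.trans_le (mul_nonneg (by positivity)
        (Finset.sum_nonneg fun i _ => Set.indicator_nonneg (fun _ _ => zero_le_one) _)))
    · have h := hbp' n
      rw [hp, ← hf.law_lt_eq_law_le hflat] at h
      obtain ⟨w, hw0, hw, hwt⟩ := exists_lt_lt_law_lt h0 h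
      exact ae_eventually_lt_score hd hf hX hind hP hK hη hw0 hw hwt
  filter_upwards [ae_all_iff.2 hupper, ae_all_iff.2 hlower] with ω hu hl
  refine tendsto_order.2 ⟨fun t ht => ?_, fun t ht => ?_⟩
  · obtain ⟨n, hn⟩ := (hb'.eventually (lt_mem_nhds ht)).exists
    exact (hl n).mono fun m hm => hn.trans hm
  · obtain ⟨n, hn⟩ := (hb.eventually (gt_mem_nhds ht)).exists
    exact (hu n).mono fun m hm => hm.trans hn

end LPE

theorem theorem2 {d : ℕ} {Ω : Type*} [MeasurableSpace Ω] (μ : Measure Ω) [IsProbabilityMeasure μ]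
    (f₀ : EuclideanSpace ℝ (Fin d) → ℝ) (hf₀ : LPE.IsCubeDensity f₀)
    (hflat : LPE.NoFlatSpots (LPE.uniformDensity d) f₀)
    (lamM : ℝ) (hH : LPE.HessianDominatedOn f₀ (interior (Function.support f₀)) lamM)
    (β : ℝ) (hβ : 0 < β) (hlow : ∀ x ∈ Function.support f₀, β ≤ f₀ x)
    (X : ℕ → Ω → EuclideanSpace ℝ (Fin d))
    (hindep : iIndepFun X μ) (hlaw : ∀ i, HasLaw (X i) (LPE.law f₀) μ)
    (K : ℕ → ℕ)
    (hK : (fun m => (K m : ℝ)) =Θ[atTop] fun m : ℕ => (m : ℝ) ^ (2 / 5 : ℝ)) :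
    ∀ η ∈ LPE.cube d, η ∉ frontier (Function.support f₀) →
      ∀ᵐ ω ∂μ, Tendsto
        (fun m : ℕ => |LPE.score (K m) m (fun i => X i ω) η
          - LPE.pValue (LPE.uniformDensity d) f₀ η|)
        atTop (𝓝 0) := by
  intro η hη hηA
  -- `HasLaw` gives only almost-everywhere measurability, so measurable versions are used; countably
  -- many changes cost a null set.
  have hmk : ∀ i, X i =ᵐ[μ] (hlaw i).aemeasurable.mk (X i) :=
    fun i => (hlaw i).aemeasurable.ae_eq_mk
  have h := LPE.ae_tendsto_score hf₀ hflat (fun i => (hlaw i).aemeasurable.measurable_mk)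
    (hindep.congr hmk) (fun i => (Measure.map_congr (hmk i)).symm.trans (hlaw i).map_eq) hK
    (LPE.continuousAt_of_notMem_frontier_support hH.1 hηA) hη
  filter_upwards [h, ae_all_iff.2 hmk] with ω hω heq
  simp only [heq]
  simpa using (hω.sub_const (LPE.pValue (LPE.uniformDensity d) f₀ η)).abs
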